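/- Conventions. $\Sigma$ is a finite alphabet. A synchronous transducer over a finite alphabet $\Gamma$ is a finite automaton with one initial state whose transitions $q \xrightarrow{a/b} q'$ are labelled by pairs $(a,b)\in\Gamma\times\Gamma$; it recognizes a set of pairs of words of equal length. A synchronous rational graph $G$ labelled by $\Sigma$ is given by a finite alphabet $\Gamma$ and synchronous transducers $(T_a)_{a\in\Sigma}$ over $\Gamma$: its vertices are words over $\Gamma$, and there is an edge $u\xrightarrow{a}v$ iff $(u,v)$ is recognized by $T_a$. For $I,F\subseteq\Gamma^*$, $L(G,I,F)$ is the set of labels $w\in\Sigma^*$ of the (possibly empty) paths of $G$ from a vertex of $I$ to a vertex of $F$. For a rational language $K\subseteq\Gamma^*$, $T_K$ denotes the minimal synchronous transducer recognizing the identity relation over $K$ (the minimal trimmed deterministic automaton of $K$, without sink state, with each letter $a$ replaced by $a/a$). The graph $G=(T_a)_{a\in\Sigma}$, with $T=\{T_a \mid a\in\Sigma\}$, is *globally deterministic* between two rational languages $I,F\subseteq\Gamma^*$ if - every $T_a$ is deterministic, i.e. from each state there is at most one transition with a given label $a/b$; and - for all $T_1\in T\cup\{T_I\}$ and $T_2\in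 T\cup\{T_F\}$ and all control states $q_1$ of $T_1$ and $q_2$ of $T_2$, there is at most one letter $b$ such that $q_1\xrightarrow{a/b}q_1'$ in $T_1$ and $q_2\xrightarrow{b/c}q_2'$ in $T_2$ for some $a,c\in\Gamma$ and some states $q_1'$ of $T_1$ and $q_2'$ of $T_2$. A language is *deterministic context-sensitive* if it is accepted by a deterministic linearly bounded machine, i.e. a deterministic Turing machine (with finitely many states and tape letters) that works only on the tape cells occupied by its input, delimited by two endmarkers. **Theorem.** Let $L\subseteq\Sigma^*$ be a language that does not contain the empty word. The following two properties are equivalent: 1. $L$ is a deterministic context-sensitive language. 2. There are a synchronous rational graph $G$ and two rational sets $I$ and $F$ of vertices such that $L=L(G,I,F)$ and $G$ is globally deterministic between $I$ and $F$. -/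

import Mathlib

/-- A synchronous transducer over the alphabet `Γ`: a finite automaton with a single initial state
whose transitions `q --a/b--> q'` are labelled by pairs of letters `(a, b) ∈ Γ × Γ`. -/
structure SyncTransducer (Γ : Type) where
  State : Type
  finite_state : Finite State
  init : State
  final : Set State
  trans : State → Γ → Γ → State → Prop

namespace SyncTransducer

variable {Γ : Type}

/-- `T.Run p u v q`: there is a sequence of transitions from `p` to `q` labelled by `u/v`. -/
inductive Run (T : SyncTransducer Γ) : T.State → List Γ → List Γ → T.State → Prop
  | nil (q : T.State) : Run T q [] [] q
  | cons {p q r : T.State} {a b : Γ} {u v : List Γ} :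
      T.trans p a b q → Run T q u v r → Run T p (a :: u) (b :: v) r

/-- The relation on words recognized by the transducer. -/
def Rel (T : SyncTransducer Γ) (u v : List Γ) : Prop :=
  ∃ q ∈ T.final, T.Run T.init u v q

/-- From each state there is at most one transition with a given label `a/b`. -/
def IsDeterministic (T : SyncTransducer Γ) : Prop :=
  ∀ q a b q' q'', T.trans q a b q' → T.trans q a b q'' → q' = q''

/-- For all control states `q₁` of `T₁` and `q₂` of `T₂` there is at most one letter `b` such that
`q₁ --a/b--> q₁'` in `T₁` and `q₂ --b/c--> q₂'` in `T₂` for some `a`, `c`, `q₁'`, `q₂'`. -/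
def AtMostOneLink (T₁ T₂ : SyncTransducer Γ) : Prop :=
  ∀ (q₁ : T₁.State) (q₂ : T₂.State) (b b' : Γ),
    (∃ a c q₁' q₂', T₁.trans q₁ a b q₁' ∧ T₂.trans q₂ b c q₂') →
    (∃ a c q₁' q₂', T₁.trans q₁ a b' q₁' ∧ T₂.trans q₂ b' c q₂') →
    b = b'

/-- The minimal synchronous transducer recognizing the identity relation over the rational language
`L`: the minimal (partial, trimmed) deterministic automaton of `L`, each letter `a` being replaced
by `a/a`. Its states are the initial state `L` and the nonempty left quotients of `L`; there is no
sink state, and no transition leads to the empty language. -/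
def identityOn (L : Language Γ) (hL : L.IsRegular) : SyncTransducer Γ where
  State := {K : Language Γ // (∃ u, K = L.leftQuotient u) ∧ (K = L ∨ ∃ v, v ∈ K)}
  finite_state := by
    refine Set.Finite.to_subtype (hL.finite_range_leftQuotient.subset ?_)
    rintro K ⟨⟨u, rfl⟩, -⟩
    exact ⟨u, rfl⟩
  init := ⟨L, ⟨[], rfl⟩, Or.inl rfl⟩
  final := {K | [] ∈ K.1}
  trans K a b K' := a = b ∧ K'.1 = K.1.leftQuotient [a] ∧ ∃ v, v ∈ K'.1

end SyncTransducer

/-- A synchronous rational graph labelled by `A` with vertices in `Γ*`: a tuple of synchronous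
transducers `(T_a)_{a ∈ A}` over `Γ`. -/
def SyncRationalGraph (A : Type*) (Γ : Type) := A → SyncTransducer Γ

namespace SyncRationalGraph

variable {A : Type*} {Γ : Type}

/-- There is an edge `s --a--> t` iff `(s, t)` is recognized by the transducer `T_a`. -/
def Edge (G : SyncRationalGraph A Γ) (s : List Γ) (a : A) (t : List Γ) : Prop :=
  (G a).Rel s t

/-- `G.Path s w t`: there is a path from `s` to `t` labelled by `w`. -/
inductive Path (G : SyncRationalGraph A Γ) : List Γ → List A → List Γ → Prop
  | nil (s : List Γ) : Path G s [] s
  | cons {s t r : List Γ} {a : A} {w : List A} :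
      G.Edge s a t → Path G t w r → Path G s (a :: w) r

/-- The path language `L(G, I, F)`. -/
def pathLanguage (G : SyncRationalGraph A Γ) (I F : Language Γ) : Language A :=
  {w | ∃ s ∈ I, ∃ t ∈ F, G.Path s w t}

/-- The set of transducers of `G` is globally deterministic with respect to the rational
languages `I` and `F`. -/
def IsGloballyDeterministic (G : SyncRationalGraph A Γ) (I F : Language Γ)
    (hI : I.IsRegular) (hF : F.IsRegular) : Prop :=
  (∀ T ∈ Set.range G, T.IsDeterministic) ∧
  ∀ T₁ ∈ Set.range G ∪ {SyncTransducer.identityOn I hI},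
    ∀ T₂ ∈ Set.range G ∪ {SyncTransducer.identityOn F hF},
      SyncTransducer.AtMostOneLink T₁ T₂

end SyncRationalGraph

/-- A deterministic linearly bounded machine with input alphabet `A`, tape alphabet `Γ` (together
with two endmarkers) and control states `Q`. The machine works on the portion of the tape occupied
by its input, delimited by the two endmarkers, which it may read but neither overwrite nor cross.
* `input` embeds the input alphabet into the tape alphabet;
* `onLeftEnd q` is the new state when the left endmarker is read (the head then moves right);
* `onRightEnd q` is the new state when the right endmarker is read (the head then moves left);
* `onLetter q x` is the new state, the letter to be written and the direction of the head move when
  the letter `x` is read.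
The value `none` means that the machine stops. -/
structure DetLBM (A : Type*) (Γ Q : Type) where
  input : A ↪ Γ
  start : Q
  accept : Set Q
  onLeftEnd : Q → Option Q
  onRightEnd : Q → Option Q
  onLetter : Q → Γ → Option (Q × Γ × Turing.Dir)

namespace DetLBM

variable {A : Type*} {Γ Q : Type}

/-- A configuration: control state, tape content between the endmarkers, and head position, where
`0` is the left endmarker, `1, …, n` are the `n` tape cells and `n + 1` is the right endmarker. -/
structure Cfg (Γ Q : Type) where
  state : Q
  tape : List Γ
  head : ℕ

/-- One computation step. -/
def step (M : DetLBM A Γ Q) (c : Cfg Γ Q) : Option (Cfg Γ Q) :=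
  match c.head with
  | 0 => (M.onLeftEnd c.state).map fun q => ⟨q, c.tape, 1⟩
  | i + 1 =>
    match c.tape[i]? with
    | none => (M.onRightEnd c.state).map fun q => ⟨q, c.tape, i⟩
    | some x => (M.onLetter c.state x).map fun r =>
        ⟨r.1, c.tape.set i r.2.1,
          match r.2.2 with
          | Turing.Dir.left => i
          | Turing.Dir.right => i + 2⟩

/-- The initial configuration on input `w`, with the head on the left endmarker. -/
def initial (M : DetLBM A Γ Q) (w : List A) : Cfg Γ Q :=
  ⟨M.start, w.map M.input, 0⟩

/-- The language accepted by the machine: the words from which an accepting state is reached. -/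
def language (M : DetLBM A Γ Q) : Language A :=
  {w | ∃ c, StateTransition.Reaches M.step (M.initial w) c ∧ c.state ∈ M.accept}

end DetLBM

/-- A language is deterministic context-sensitive if it is accepted by a deterministic linearly
bounded machine with finitely many tape letters and control states. -/
def Language.IsDetContextSensitive {A : Type*} (L : Language A) : Prop :=
  ∃ (Γ Q : Type) (_ : Finite Γ) (_ : Finite Q) (M : DetLBM A Γ Q), M.language = L

/-! A path labelled `a₁ … aₙ` through words `u₀, …, uₙ` of equal length is a rectangle of letters in
which the transducer of `aᵢ` reads the pair `(uᵢ₋₁, uᵢ)`. Read position by position instead of word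
by word, it is a computation of a chain of `n` cells: cell `i` holds the state of the transducer of
`aᵢ`, the letters at position `j` are what neighbours exchange at time `j`, and two end cells run
automata for `I` and `F`. `CellChain` is this model, and `accepting_iff_colRel` is the change of
viewpoint. Global determinism becomes the condition that neighbours agree on at most one letter,
which makes the global step a partial function (`step_unique`). The lemmas `exists_graph` and
`exists_cellChain` pass between graphs and deterministic chains.

It remains to compare chains with linearly bounded machines. The tape cells of a machine form a
chain in which neighbours exchange crossings of the head (`deterministic_cellChain`,
`language_eq_accepting`). Conversely, a machine simulates one global step by a round trip: going
right it computes the letter on each link, going left it updates the cells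
(`isDetContextSensitive`). -/

/-! ### Languages of partial deterministic automata -/

/-- The language recognized from a state by an automaton with transition relation `tr` and set of
final states `fin`. -/
def wordsFrom {S Γ : Type} (tr : S → Γ → S → Prop) (fin : Set S) (s : S) : Language Γ :=
  {u | List.rec (motive := fun _ => S → Prop) (fun s => s ∈ fin)
    (fun a _ ih s => ∃ s', tr s a s' ∧ ih s') u s}

section WordsFrom

variable {S Γ : Type} {tr : S → Γ → S → Prop} {fin : Set S}

theorem cons_mem_wordsFrom {s : S} {a : Γ} {u : List Γ} :
    a :: u ∈ wordsFrom tr fin s ↔ ∃ s', tr s a s' ∧ u ∈ wordsFrom tr fin s' := Iff.rfl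

/-- Reading `u` from `s` leads to at most one state. This bounds the number of quotients, and it
also matches the states of the minimal automaton with states of the given one. -/
theorem leftQuotient_wordsFrom (hdet : ∀ s a s' s'', tr s a s' → tr s a s'' → s' = s'')
    (u : List Γ) (s : S) :
    (∀ v, v ∉ (wordsFrom tr fin s).leftQuotient u) ∨
      ∃ s', (wordsFrom tr fin s).leftQuotient u = wordsFrom tr fin s' := by
  induction u generalizing s with
  | nil => exact Or.inr ⟨s, rfl⟩
  | cons a u ih =>
    by_cases h : ∃ s', tr s a s'
    · obtain ⟨s', hs'⟩ := h
      have e : (wordsFrom tr fin s).leftQuotient (a :: u) =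
          (wordsFrom tr fin s').leftQuotient u := by
        ext v
        rw [Language.mem_leftQuotient, Language.mem_leftQuotient, List.cons_append,
          cons_mem_wordsFrom]
        refine ⟨?_, fun h => ⟨s', hs', h⟩⟩
        rintro ⟨t, ht, hv⟩
        rwa [hdet _ _ _ _ hs' ht]
      rw [e]
      exact ih s'
    · refine Or.inl fun v hv => h ?_
      rw [Language.mem_leftQuotient, List.cons_append, cons_mem_wordsFrom] at hv
      exact ⟨_, hv.choose_spec.1⟩

theorem isRegular_wordsFrom [Finite S]
    (hdet : ∀ s a s' s'', tr s a s' → tr s a s'' → s' = s'') (s : S) :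
    (wordsFrom tr fin s).IsRegular := by
  rw [Language.isRegular_iff_finite_range_leftQuotient]
  refine ((Set.finite_range (wordsFrom tr fin)).union (Set.finite_singleton 0)).subset ?_
  rintro _ ⟨u, rfl⟩
  rcases leftQuotient_wordsFrom (fin := fin) hdet u s with h | ⟨s', h⟩
  · exact Or.inr (Language.ext fun v => iff_of_false (h v) (Language.notMem_zero v))
  · exact Or.inl ⟨s', h.symm⟩

/-- A transition of the identity transducer over `wordsFrom tr fin s` comes from `tr`. -/
theorem exists_tr_of_identityOn (hdet : ∀ s a s' s'', tr s a s' → tr s a s'' → s' = s'') (s : S)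
    (hr : (wordsFrom tr fin s).IsRegular)
    (K : (SyncTransducer.identityOn (wordsFrom tr fin s) hr).State) :
    ∃ t, ∀ a b K', (SyncTransducer.identityOn (wordsFrom tr fin s) hr).trans K a b K' →
      a = b ∧ ∃ t', tr t b t' := by
  obtain ⟨K, ⟨u, hu⟩, hK⟩ := K
  rcases leftQuotient_wordsFrom (fin := fin) hdet u s with h | ⟨s', h⟩
  -- `s` is a dummy here: the quotient `K` is empty, so no transition leaves it.
  · refine ⟨s, ?_⟩
    rintro a b K' ⟨-, e, v, hv⟩
    rw [e] at hv
    subst hu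
    exact absurd hv (h _)
  · refine ⟨s', ?_⟩
    rintro a b K' ⟨rfl, e, v, hv⟩
    rw [e] at hv
    subst hu
    simp only [h] at hv
    exact ⟨rfl, _, (cons_mem_wordsFrom.1 hv).choose_spec.1⟩

end WordsFrom

/-! ### Chains of cells and composed relations -/

/-- A family of finite chains of cells: a left end cell with states `L`, inner cells with states `C`
and a right end cell with states `R`. In one global step each cell exchanges one letter of `Γ` with
each of its neighbours. -/
structure CellChain (Γ : Type) where
  L : Type
  C : Type
  R : Type
  trL : L → Γ → L → Prop
  trC : C → Γ → Γ → C → Prop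
  trR : R → Γ → R → Prop
  finL : Set L
  finC : Set C
  finR : Set R

namespace CellChain

variable {Γ : Type} (X : CellChain Γ)

/-- The cell may send the letter to its right neighbour. -/
def Emits : X.L ⊕ X.C → Γ → Prop
  | Sum.inl l, b => ∃ l', X.trL l b l'
  | Sum.inr q, b => ∃ a q', X.trC q a b q'

/-- The cell may exchange the letter with its left neighbour. -/
def Receives : X.C ⊕ X.R → Γ → Prop
  | Sum.inl q, b => ∃ c q', X.trC q b c q'
  | Sum.inr r, b => ∃ r', X.trR r b r'

/-- Every cell is deterministic and two neighbours agree on at most one letter. -/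
structure Deterministic : Prop where
  left : ∀ l b l' l'', X.trL l b l' → X.trL l b l'' → l' = l''
  inner : ∀ q a b q' q'', X.trC q a b q' → X.trC q a b q'' → q' = q''
  right : ∀ r b r' r'', X.trR r b r' → X.trR r b r'' → r' = r''
  link : ∀ p s b b', X.Emits p b → X.Receives s b → X.Emits p b' → X.Receives s b' → b = b'

/-- A simultaneous transition of consecutive inner cells, with given letters exchanged at the left
and at the right. -/
inductive ColStep : List X.C → Γ → Γ → List X.C → Prop
  | nil (a : Γ) : ColStep [] a a []
  | cons {q q' : X.C} {qs qs' : List X.C} {a b c : Γ} :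
      X.trC q a b q' → ColStep qs b c qs' → ColStep (q :: qs) a c (q' :: qs')

/-- A global state of the chain. -/
abbrev Config := X.L × List X.C × X.R

/-- The global step relation. -/
def Step (g g' : X.Config) : Prop :=
  ∃ a c, X.trL g.1 a g'.1 ∧ X.ColStep g.2.1 a c g'.2.1 ∧ X.trR g.2.2 c g'.2.2

/-- All cells are in a final state. -/
def Final (g : X.Config) : Prop :=
  g.1 ∈ X.finL ∧ (∀ q ∈ g.2.1, q ∈ X.finC) ∧ g.2.2 ∈ X.finR

/-- A final global state is reachable. -/
def Accepting (g : X.Config) : Prop :=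
  ∃ g', Relation.ReflTransGen X.Step g g' ∧ X.Final g'

/-- The words recognized from a state of an inner cell, seen as a transducer. -/
def CellRel : X.C → List Γ → List Γ → Prop
  | q, [], [] => q ∈ X.finC
  | q, a :: u, b :: v => ∃ q', X.trC q a b q' ∧ CellRel q' u v
  | _, _, _ => False

/-- The composition of the relations recognized from the states of a list of cells. -/
def ColRel : List X.C → List Γ → List Γ → Prop
  | [], u, v => u = v
  | q :: qs, u, v => ∃ z, X.CellRel q u z ∧ ColRel qs z v

variable {X}

theorem ColStep.append {qs₁ qs₁' qs₂ qs₂' : List X.C} {a b c : Γ} (h₁ : X.ColStep qs₁ a b qs₁')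
    (h₂ : X.ColStep qs₂ b c qs₂') : X.ColStep (qs₁ ++ qs₂) a c (qs₁' ++ qs₂') := by
  induction h₁ with
  | nil => exact h₂
  | cons h _ ih => exact .cons h (ih h₂)

/-- The letters are determined from left to right: the link between `p` and the first cell fixes the
first letter, then that cell takes the role of `p`. The last link is the one with `r`. -/
theorem Deterministic.colStep_unique (hX : X.Deterministic) {qs qs' qs'' : List X.C}
    {p : X.L ⊕ X.C} {r r' r'' : X.R} {b b' c c' : Γ}
    (hp : X.Emits p b) (hp' : X.Emits p b') (h : X.ColStep qs b c qs') (h' : X.ColStep qs b' c' qs'')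
    (hr : X.trR r c r') (hr' : X.trR r c' r'') : b = b' ∧ c = c' ∧ qs' = qs'' := by
  induction h generalizing p b' qs'' with
  | nil b =>
    cases h'
    have := hX.link p (.inr r) _ _ hp ⟨_, hr⟩ hp' ⟨_, hr'⟩
    exact ⟨this, this, rfl⟩
  | cons hq hqs ih =>
    cases h' with
    | cons hq' hqs' =>
      obtain rfl := hX.link p (.inl _) _ _ hp ⟨_, _, hq⟩ hp' ⟨_, _, hq'⟩
      obtain ⟨rfl, rfl, rfl⟩ := ih (p := .inr _) ⟨_, _, hq⟩ ⟨_, _, hq'⟩ hqs' hr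
      rw [hX.inner _ _ _ _ _ hq hq']
      exact ⟨rfl, rfl, rfl⟩

theorem Deterministic.step_unique (hX : X.Deterministic) {g g' g'' : X.Config} (h : X.Step g g')
    (h' : X.Step g g'') : g' = g'' := by
  obtain ⟨l, qs, r⟩ := g
  obtain ⟨l', qs', r'⟩ := g'
  obtain ⟨l'', qs'', r''⟩ := g''
  obtain ⟨a, c, hl, hq, hr⟩ := h
  obtain ⟨a', c', hl', hq', hr'⟩ := h'
  dsimp only at *
  obtain ⟨rfl, rfl, rfl⟩ :=
    hX.colStep_unique (p := .inl l) ⟨_, hl⟩ ⟨_, hl'⟩ hq hq' hr hr'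
  rw [hX.left _ _ _ _ hl hl', hX.right _ _ _ _ hr hr']

theorem accepting_iff {g : X.Config} :
    X.Accepting g ↔ X.Final g ∨ ∃ g', X.Step g g' ∧ X.Accepting g' := by
  constructor
  · rintro ⟨g', h, hf⟩
    rcases Relation.ReflTransGen.cases_head h with rfl | ⟨g₁, h₁, h₂⟩
    · exact Or.inl hf
    · exact Or.inr ⟨g₁, h₁, g', h₂, hf⟩
  · rintro (h | ⟨g₁, h₁, g', h₂, hf⟩)
    · exact ⟨g, .refl, h⟩
    · exact ⟨g', .head h₁ h₂, hf⟩

theorem cellRel_nil_left {q : X.C} {v : List Γ} : X.CellRel q [] v ↔ v = [] ∧ q ∈ X.finC := by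
  cases v <;> simp [CellRel]

theorem cellRel_cons_left {q : X.C} {a : Γ} {u v : List Γ} :
    X.CellRel q (a :: u) v ↔ ∃ b v' q', v = b :: v' ∧ X.trC q a b q' ∧ X.CellRel q' u v' := by
  cases v with
  | nil => simp [CellRel]
  | cons b v =>
    simp only [CellRel, List.cons.injEq]
    constructor
    · rintro ⟨q', h, h'⟩
      exact ⟨b, v, q', ⟨rfl, rfl⟩, h, h'⟩
    · rintro ⟨_, _, q', ⟨rfl, rfl⟩, h, h'⟩
      exact ⟨q', h, h'⟩

theorem colRel_nil_left {qs : List X.C} {v : List Γ} :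
    X.ColRel qs [] v ↔ v = [] ∧ ∀ q ∈ qs, q ∈ X.finC := by
  induction qs with
  | nil => simp [ColRel, eq_comm]
  | cons q qs ih =>
    simp only [ColRel, cellRel_nil_left, List.forall_mem_cons]
    constructor
    · rintro ⟨_, ⟨rfl, h⟩, h'⟩
      exact ⟨(ih.1 h').1, h, (ih.1 h').2⟩
    · rintro ⟨h, h', h''⟩
      exact ⟨[], ⟨rfl, h'⟩, ih.2 ⟨h, h''⟩⟩

/-- The exchange of rows and columns: removing the first letter from all the words of a composition
amounts to one simultaneous step of the cells. -/
theorem colRel_cons_left {qs : List X.C} {a : Γ} {u v : List Γ} :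
    X.ColRel qs (a :: u) v ↔
      ∃ c v' qs', v = c :: v' ∧ X.ColStep qs a c qs' ∧ X.ColRel qs' u v' := by
  induction qs generalizing a u with
  | nil =>
    constructor
    · rintro rfl
      exact ⟨a, u, [], rfl, .nil a, rfl⟩
    · rintro ⟨c, v', qs', rfl, h, h'⟩
      cases h
      cases h'
      rfl
  | cons q qs ih =>
    constructor
    · rintro ⟨z, hz, h⟩
      obtain ⟨b, z', q', rfl, hq, hz'⟩ := cellRel_cons_left.1 hz
      obtain ⟨c, v', qs', rfl, hs, hr⟩ := ih.1 h
      exact ⟨c, v', q' :: qs', rfl, .cons hq hs, z', hz', hr⟩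
    · rintro ⟨c, v', qs', rfl, h, h'⟩
      cases h with
      | cons hq hs =>
        obtain ⟨z, hz, hr⟩ := h'
        exact ⟨_ :: z, cellRel_cons_left.2 ⟨_, _, _, rfl, hq, hz⟩, ih.2 ⟨_, _, _, rfl, hs, hr⟩⟩

/-- The words `u` and `v` are the histories of the letters exchanged by the left and right end
cells, so the induction on the steps of the run is an induction on the letters of `u`. -/
theorem accepting_iff_colRel {l : X.L} {qs : List X.C} {r : X.R} :
    X.Accepting (l, qs, r) ↔ ∃ u ∈ wordsFrom X.trL X.finL l, ∃ v ∈ wordsFrom X.trR X.finR r,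
      X.ColRel qs u v := by
  constructor
  · rintro ⟨g', h, hf⟩
    generalize hg : (l, qs, r) = g at h
    induction h using Relation.ReflTransGen.head_induction_on generalizing l qs r with
    | refl =>
      subst hg
      exact ⟨[], hf.1, [], hf.2.2, colRel_nil_left.2 ⟨rfl, hf.2.1⟩⟩
    | @head g g₁ h₁ _ ih =>
      subst hg
      obtain ⟨a, c, hl, hq, hr⟩ := h₁
      obtain ⟨u, hu, v, hv, h⟩ := ih rfl
      exact ⟨a :: u, ⟨_, hl, hu⟩, c :: v, ⟨_, hr, hv⟩, colRel_cons_left.2 ⟨_, _, _, rfl, hq, h⟩⟩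
  · rintro ⟨u, hu, v, hv, h⟩
    induction u generalizing l qs r v with
    | nil =>
      obtain ⟨rfl, hq⟩ := colRel_nil_left.1 h
      exact ⟨_, .refl, hu, hq, hv⟩
    | cons a u ih =>
      obtain ⟨c, v, qs', rfl, hq, h'⟩ := colRel_cons_left.1 h
      obtain ⟨l', hl, hu'⟩ := cons_mem_wordsFrom.1 hu
      obtain ⟨r', hr, hv'⟩ := cons_mem_wordsFrom.1 hv
      exact accepting_iff.2 (Or.inr ⟨(l', qs', r'), ⟨a, c, hl, hq, hr⟩, ih hu' v hv' h'⟩)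

/-- If each transducer of a graph recognizes the relation of a cell state, then the paths of the
graph are given by the composition of these relations. -/
theorem path_iff_colRel {A : Type*} {G : SyncRationalGraph A Γ} {init : A → X.C}
    (h : ∀ a u v, G.Edge u a v ↔ X.CellRel (init a) u v) {s t : List Γ} {w : List A} :
    G.Path s w t ↔ X.ColRel (w.map init) s t := by
  induction w generalizing s with
  | nil =>
    constructor
    · rintro ⟨⟩
      rfl
    · rintro ⟨⟩
      exact .nil _
  | cons a w ih =>
    constructor
    · intro hp
      cases hp with
      | cons he hp => exact ⟨_, (h _ _ _).1 he, ih.1 hp⟩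
    · rintro ⟨z, hz, hp⟩
      exact .cons ((h _ _ _).2 hz) (ih.2 hp)

theorem pathLanguage_eq {A : Type*} {G : SyncRationalGraph A Γ} {init : A → X.C} {l : X.L} {r : X.R}
    (h : ∀ a u v, G.Edge u a v ↔ X.CellRel (init a) u v) :
    G.pathLanguage (wordsFrom X.trL X.finL l) (wordsFrom X.trR X.finR r) =
      {w | X.Accepting (l, w.map init, r)} := by
  ext w
  change (∃ s ∈ _, ∃ t ∈ _, G.Path s w t) ↔ X.Accepting _
  rw [accepting_iff_colRel]
  simp only [path_iff_colRel h]

end CellChain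

/-! ### Deterministic chains versus globally deterministic graphs -/

/-- A cell whose states include those of a transducer, with the same transitions from them,
recognizes the same relation. -/
theorem SyncTransducer.exists_run_iff_cellRel {Γ : Type} {X : CellChain Γ} (T : SyncTransducer Γ)
    (f : T.State → X.C) (hfin : ∀ q, f q ∈ X.finC ↔ q ∈ T.final)
    (htr : ∀ q a b s, X.trC (f q) a b s ↔ ∃ q', T.trans q a b q' ∧ f q' = s)
    {q : T.State} {u v : List Γ} :
    (∃ q' ∈ T.final, T.Run q u v q') ↔ X.CellRel (f q) u v := by
  induction u generalizing q v with
  | nil =>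
    rw [CellChain.cellRel_nil_left, hfin]
    constructor
    · rintro ⟨q', hq', h⟩
      cases h
      exact ⟨rfl, hq'⟩
    · rintro ⟨rfl, h⟩
      exact ⟨q, h, .nil q⟩
  | cons a u ih =>
    rw [CellChain.cellRel_cons_left]
    constructor
    · rintro ⟨q', hq', h⟩
      cases h with
      | cons h h' => exact ⟨_, _, _, rfl, (htr _ _ _ _).2 ⟨_, h, rfl⟩, ih.1 ⟨q', hq', h'⟩⟩
    · rintro ⟨b, v, s, rfl, h, h'⟩
      obtain ⟨q₁, hq₁, rfl⟩ := (htr _ _ _ _).1 h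
      obtain ⟨q', hq', hr⟩ := ih.2 h'
      exact ⟨q', hq', .cons hq₁ hr⟩

/-- A language accepted by deterministic chains is a path language of a globally deterministic
synchronous rational graph. -/
theorem CellChain.Deterministic.exists_graph {Γ : Type} {X : CellChain Γ} (hX : X.Deterministic)
    [Finite X.L] [Finite X.C] [Finite X.R] {A : Type*} (init : A → X.C) (l : X.L) (r : X.R) :
    ∃ (G : SyncRationalGraph A Γ) (I F : Language Γ) (hI : I.IsRegular) (hF : F.IsRegular),
      {w | X.Accepting (l, w.map init, r)} = G.pathLanguage I F ∧
        G.IsGloballyDeterministic I F hI hF := by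
  -- All labels share the inner cell as transducer and differ only in the initial state.
  let G : SyncRationalGraph A Γ := fun a => ⟨X.C, inferInstance, init a, X.finC, X.trC⟩
  have hI : (wordsFrom X.trL X.finL l).IsRegular := isRegular_wordsFrom hX.left l
  have hF : (wordsFrom X.trR X.finR r).IsRegular := isRegular_wordsFrom hX.right r
  refine ⟨G, _, _, hI, hF, ?_, ?_, ?_⟩
  · refine (pathLanguage_eq fun a u v => ?_).symm
    exact (G a).exists_run_iff_cellRel (X := X) id (fun _ => Iff.rfl)
      (fun q a b s => ⟨fun h => ⟨s, h, rfl⟩, by rintro ⟨_, h, rfl⟩; exact h⟩)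
  · rintro _ ⟨a, rfl⟩
    exact hX.inner
  -- The end transducers are minimal automata, not the end cells themselves. It suffices that each
  -- of their states allows no more letters than some state of the end cell.
  · have emits : ∀ T ∈ Set.range G ∪ {SyncTransducer.identityOn _ hI}, ∀ q : T.State,
        ∃ p, ∀ a b q', T.trans q a b q' → X.Emits p b := by
      rintro _ (⟨a, rfl⟩ | rfl) q
      · exact ⟨.inr q, fun a b q' h => ⟨a, q', h⟩⟩
      · obtain ⟨t, ht⟩ := exists_tr_of_identityOn hX.left l hI q
        exact ⟨.inl t, fun a b q' h => (ht a b q' h).2⟩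
    have receives : ∀ T ∈ Set.range G ∪ {SyncTransducer.identityOn _ hF}, ∀ q : T.State,
        ∃ s, ∀ b c q', T.trans q b c q' → X.Receives s b := by
      rintro _ (⟨a, rfl⟩ | rfl) q
      · exact ⟨.inl q, fun b c q' h => ⟨c, q', h⟩⟩
      · obtain ⟨t, ht⟩ := exists_tr_of_identityOn hX.right r hF q
        refine ⟨.inr t, fun b c q' h => ?_⟩
        obtain ⟨rfl, h'⟩ := ht b c q' h
        exact h'
    rintro T₁ h₁ T₂ h₂ q₁ q₂ b b' ⟨a, c, q₁', q₂', hb₁, hb₂⟩ ⟨a', c', q₁'', q₂'', hb₁', hb₂'⟩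
    obtain ⟨p, hp⟩ := emits T₁ h₁ q₁
    obtain ⟨s, hs⟩ := receives T₂ h₂ q₂
    exact hX.link p s b b' (hp _ _ _ hb₁) (hs _ _ _ hb₂) (hp _ _ _ hb₁') (hs _ _ _ hb₂')

/-- The states of the identity transducer recognize themselves. -/
theorem wordsFrom_identityOn {Γ : Type} (I : Language Γ) (hI : I.IsRegular)
    (K : (SyncTransducer.identityOn I hI).State) :
    wordsFrom (fun K b K' => (SyncTransducer.identityOn I hI).trans K b b K')
      (SyncTransducer.identityOn I hI).final K = K.1 := by
  ext u
  induction u generalizing K with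
  | nil => exact Iff.rfl
  | cons a u ih =>
    rw [cons_mem_wordsFrom]
    constructor
    · rintro ⟨K', ⟨-, h, -⟩, hu⟩
      have := (ih K').1 hu
      rw [h] at this
      exact this
    · intro h
      have hne : u ∈ K.1.leftQuotient [a] := h
      obtain ⟨v, hv⟩ := K.2.1
      refine ⟨⟨K.1.leftQuotient [a], ⟨v ++ [a], ?_⟩, Or.inr ⟨u, hne⟩⟩, ⟨rfl, rfl, u, hne⟩,
        (ih _).2 hne⟩
      rw [Language.leftQuotient_append, ← hv]

/-- The path language of a globally deterministic synchronous rational graph is accepted by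
deterministic chains. -/
theorem SyncRationalGraph.IsGloballyDeterministic.exists_cellChain {A : Type*} [Finite A] {Γ : Type}
    {G : SyncRationalGraph A Γ} {I F : Language Γ} {hI : I.IsRegular} {hF : F.IsRegular}
    (h : G.IsGloballyDeterministic I F hI hF) :
    ∃ X : CellChain Γ, X.Deterministic ∧ Finite X.L ∧ Finite X.C ∧ Finite X.R ∧
      ∃ (init : A ↪ X.C) (l : X.L) (r : X.R),
        G.pathLanguage I F = {w | X.Accepting (l, w.map init, r)} := by
  -- Cell states live in `Type` while `A` is in any universe, so labels become indices in `Fin n`.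
  -- Tagging states by these indices also makes the map to initial states injective, as a machine's
  -- input embedding requires.
  obtain ⟨n, ⟨e⟩⟩ := Finite.exists_equiv_fin A
  have hfin : ∀ i, Finite (G (e.symm i)).State := fun i => (G _).finite_state
  let TI := SyncTransducer.identityOn I hI
  let TF := SyncTransducer.identityOn F hF
  let X : CellChain Γ :=
    { L := TI.State
      C := Σ i : Fin n, (G (e.symm i)).State
      R := TF.State
      trL := fun K b K' => TI.trans K b b K'
      trC := fun q a b s => ∃ q', (G (e.symm q.1)).trans q.2 a b q' ∧ ⟨q.1, q'⟩ = s
      trR := fun K b K' => TF.trans K b b K'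
      finL := TI.final
      finC := {q | q.2 ∈ (G (e.symm q.1)).final}
      finR := TF.final }
  have hinj : Function.Injective fun a => (⟨e a, (G (e.symm (e a))).init⟩ : X.C) :=
    fun a b hab => e.injective (congrArg Sigma.fst hab)
  refine ⟨X, ⟨?_, ?_, ?_, ?_⟩, TI.finite_state, ?_, TF.finite_state, ⟨_, hinj⟩, TI.init, TF.init,
    ?_⟩
  · rintro K b K' K'' ⟨-, h', -⟩ ⟨-, h'', -⟩
    exact Subtype.ext (h'.trans h''.symm)
  · rintro q a b _ _ ⟨q', hq', rfl⟩ ⟨q'', hq'', rfl⟩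
    rw [h.1 _ ⟨_, rfl⟩ _ _ _ _ _ hq' hq'']
  · rintro K b K' K'' ⟨-, h', -⟩ ⟨-, h'', -⟩
    exact Subtype.ext (h'.trans h''.symm)
  · have emits : ∀ p : X.L ⊕ X.C, ∃ T ∈ Set.range G ∪ {TI}, ∃ q : T.State, ∀ b, X.Emits p b →
        ∃ a q', T.trans q a b q' := by
      rintro (K | ⟨i, q⟩)
      · refine ⟨TI, Or.inr rfl, K, ?_⟩
        rintro b ⟨K', hb⟩
        exact ⟨b, K', hb⟩
      · refine ⟨G (e.symm i), Or.inl ⟨_, rfl⟩, q, ?_⟩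
        rintro b ⟨a, _, q', hb, -⟩
        exact ⟨a, q', hb⟩
    have receives : ∀ s : X.C ⊕ X.R, ∃ T ∈ Set.range G ∪ {TF}, ∃ q : T.State, ∀ b,
        X.Receives s b → ∃ c q', T.trans q b c q' := by
      rintro (⟨i, q⟩ | K)
      · refine ⟨G (e.symm i), Or.inl ⟨_, rfl⟩, q, ?_⟩
        rintro b ⟨c, _, q', hb, -⟩
        exact ⟨c, q', hb⟩
      · refine ⟨TF, Or.inr rfl, K, ?_⟩
        rintro b ⟨K', hb⟩
        exact ⟨b, K', hb⟩
    intro p s b b' hp hs hp' hs'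
    obtain ⟨T₁, h₁, q₁, H₁⟩ := emits p
    obtain ⟨T₂, h₂, q₂, H₂⟩ := receives s
    have key : ∀ b, X.Emits p b → X.Receives s b →
        ∃ a c q₁' q₂', T₁.trans q₁ a b q₁' ∧ T₂.trans q₂ b c q₂' := by
      intro b hp hs
      obtain ⟨a, q₁', ha⟩ := H₁ b hp
      obtain ⟨c, q₂', hc⟩ := H₂ b hs
      exact ⟨a, c, q₁', q₂', ha, hc⟩
    exact h.2 T₁ h₁ T₂ h₂ q₁ q₂ b b' (key b hp hs) (key b' hp' hs')
  · exact inferInstanceAs (Finite (Σ i : Fin n, (G (e.symm i)).State))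
  · have hedge : ∀ a u v, G.Edge u a v ↔
        X.CellRel (⟨e a, (G (e.symm (e a))).init⟩ : X.C) u v := by
      intro a u v
      rw [← (G (e.symm (e a))).exists_run_iff_cellRel (X := X) (fun q => ⟨e a, q⟩)
        (fun _ => Iff.rfl) (fun _ _ _ _ => Iff.rfl), e.symm_apply_apply]
      exact Iff.rfl
    have := CellChain.pathLanguage_eq (X := X) (l := TI.init) (r := TF.init) hedge
    rwa [show wordsFrom X.trL X.finL TI.init = I from wordsFrom_identityOn I hI TI.init,
      show wordsFrom X.trR X.finR TF.init = F from wordsFrom_identityOn F hF TF.init] at this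

/-! ### From machines to chains -/

namespace DetLBM

variable {A : Type*} {Γ Q : Type}

/-- The letters exchanged by the tape cells of a machine: the head crosses to the right
(`Sum.inl`), to the left (`Sum.inr`), or not at all, a crossing carrying the control state. -/
abbrev Crossing (Q : Type) := Option (Q ⊕ Q)

/-- Transitions of the cell with the left endmarker. -/
inductive TrLeft (M : DetLBM A Γ Q) : Option Q → Crossing Q → Option Q → Prop
  | idle : TrLeft M none none none
  | enter (p : Q) : TrLeft M none (some (.inr p)) (some p)
  | leave {q p : Q} : M.onLeftEnd q = some p → TrLeft M (some q) (some (.inl p)) none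

/-- Transitions of the cell with the right endmarker. -/
inductive TrRight (M : DetLBM A Γ Q) : Option Q → Crossing Q → Option Q → Prop
  | idle : TrRight M none none none
  | enter (p : Q) : TrRight M none (some (.inl p)) (some p)
  | leave {q p : Q} : M.onRightEnd q = some p → TrRight M (some q) (some (.inr p)) none

/-- Transitions of an inner cell. -/
inductive TrInner (M : DetLBM A Γ Q) :
    Γ × Option Q → Crossing Q → Crossing Q → Γ × Option Q → Prop
  | idle (x : Γ) : TrInner M (x, none) none none (x, none)
  | enterRight (x : Γ) (p : Q) : TrInner M (x, none) (some (.inl p)) none (x, some p)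
  | enterLeft (x : Γ) (p : Q) : TrInner M (x, none) none (some (.inr p)) (x, some p)
  | leaveRight {x y : Γ} {q p : Q} : M.onLetter q x = some (p, y, .right) →
      TrInner M (x, some q) none (some (.inl p)) (y, none)
  | leaveLeft {x y : Γ} {q p : Q} : M.onLetter q x = some (p, y, .left) →
      TrInner M (x, some q) (some (.inr p)) none (y, none)

theorem TrInner.unique {M : DetLBM A Γ Q} {s s' s'' : Γ × Option Q} {a b : Crossing Q}
    (h : M.TrInner s a b s') (h' : M.TrInner s a b s'') : s' = s'' := by
  cases h <;> cases h' <;> simp_all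

/-- The chain formed by the cells of a machine. -/
def cellChain (M : DetLBM A Γ Q) : CellChain (Crossing Q) where
  L := Option Q
  C := Γ × Option Q
  R := Option Q
  trL := M.TrLeft
  trC := M.TrInner
  trR := M.TrRight
  finL := {s | ∀ q ∈ s, q ∈ M.accept}
  finC := {s | ∀ q ∈ s.2, q ∈ M.accept}
  finR := {s | ∀ q ∈ s, q ∈ M.accept}

/-- The first case is a cell with the head, whose move is forced. The second is a headless cell,
which can let the head in from the right but cannot send it there. -/
theorem emits_cellChain {M : DetLBM A Γ Q} {p : M.cellChain.L ⊕ M.cellChain.C} {b : Crossing Q}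
    (h : M.cellChain.Emits p b) :
    (∀ b', M.cellChain.Emits p b' → b' = b) ∨
      ∀ b', M.cellChain.Emits p b' → ∀ q, b' ≠ some (.inl q) := by
  rcases p with l | ⟨x, s⟩
  · obtain ⟨l', h⟩ := h
    cases h with
    | leave h =>
      left
      rintro b' ⟨l', h'⟩
      cases h' with
      | leave h' => simp_all
    | _ =>
      right
      rintro b' ⟨l', h'⟩
      cases h' <;> simp
  · obtain ⟨a, s', h⟩ := h
    cases h with
    | leaveRight h =>
      left
      rintro b' ⟨a', s', h'⟩
      cases h' <;> simp_all
    | leaveLeft h =>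
      left
      rintro b' ⟨a', s', h'⟩
      cases h' <;> simp_all
    | _ =>
      right
      rintro b' ⟨a', s', h'⟩
      cases h' <;> simp

theorem receives_cellChain {M : DetLBM A Γ Q} {s : M.cellChain.C ⊕ M.cellChain.R} {b : Crossing Q}
    (h : M.cellChain.Receives s b) :
    (∀ b', M.cellChain.Receives s b' → b' = b) ∨
      ∀ b', M.cellChain.Receives s b' → ∀ q, b' ≠ some (.inr q) := by
  rcases s with ⟨x, s⟩ | r
  · obtain ⟨a, s', h⟩ := h
    cases h with
    | leaveRight h =>
      left
      rintro b' ⟨a', s', h'⟩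
      cases h' <;> simp_all
    | leaveLeft h =>
      left
      rintro b' ⟨a', s', h'⟩
      cases h' <;> simp_all
    | _ =>
      right
      rintro b' ⟨a', s', h'⟩
      cases h' <;> simp
  · obtain ⟨r', h⟩ := h
    cases h with
    | leave h =>
      left
      rintro b' ⟨r', h'⟩
      cases h' with
      | leave h' => simp_all
    | _ =>
      right
      rintro b' ⟨r', h'⟩
      cases h' <;> simp

theorem deterministic_cellChain (M : DetLBM A Γ Q) : M.cellChain.Deterministic where
  left := by
    intro l b l' l'' h h'
    cases h <;> cases h' <;> rfl
  inner := by
    intro q a b q' q'' h h'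
    exact TrInner.unique h h'
  right := by
    intro r b r' r'' h h'
    cases h <;> cases h' <;> rfl
  link := by
    intro p s b b' hp hs hp' hs'
    rcases emits_cellChain hp with h | h
    · exact (h b' hp').symm
    rcases receives_cellChain hs with h' | h'
    · exact (h' b' hs').symm
    -- Neither neighbour has the head, so no crossing is possible in either direction.
    · have key : ∀ b, M.cellChain.Emits p b → M.cellChain.Receives s b → b = none := by
        intro b hp hs
        rcases b with _ | q | q
        · rfl
        · exact absurd rfl (h _ hp q)
        · exact absurd rfl (h' _ hs q)
      rw [key b hp hs, key b' hp' hs']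

/-- The state of an inner cell without head. -/
def headless (M : DetLBM A Γ Q) (x : Γ) : M.cellChain.C := (x, none)

/-- The state of an inner cell with the head. -/
def headed (M : DetLBM A Γ Q) (x : Γ) (q : Q) : M.cellChain.C := (x, some q)

/-- The global state of the chain of cells that represents a configuration. -/
inductive Represents (M : DetLBM A Γ Q) : Cfg Γ Q → M.cellChain.Config → Prop
  | left (q : Q) (t : List Γ) : Represents M ⟨q, t, 0⟩ (some q, t.map M.headless, none)
  | inner (q : Q) (t : List Γ) (x : Γ) (t' : List Γ) :
      Represents M ⟨q, t ++ x :: t', t.length + 1⟩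
        (none, t.map M.headless ++ M.headed x q :: t'.map M.headless, none)
  | right (q : Q) (t : List Γ) :
      Represents M ⟨q, t, t.length + 1⟩ (none, t.map M.headless, some q)

variable {M : DetLBM A Γ Q}

/-- Headless cells are final vacuously, so only the cell with the head counts. -/
theorem Represents.final_iff {c : Cfg Γ Q} {g : M.cellChain.Config} (h : M.Represents c g) :
    M.cellChain.Final g ↔ c.state ∈ M.accept := by
  have aux : ∀ t : List Γ, ∀ s ∈ t.map M.headless, s ∈ M.cellChain.finC := by
    intro t s hs
    obtain ⟨x, -, rfl⟩ := List.mem_map.1 hs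
    rintro q ⟨⟩
  have auxL : (none : Option Q) ∈ M.cellChain.finL := by rintro q ⟨⟩
  have auxR : (none : Option Q) ∈ M.cellChain.finR := by rintro q ⟨⟩
  cases h with
  | left q t =>
    refine ⟨fun h => h.1 q rfl, fun h => ⟨?_, aux t, auxR⟩⟩
    rintro _ ⟨⟩
    exact h
  | inner q t x t' =>
    refine ⟨fun h => h.2.1 (M.headed x q) (by simp) q rfl, fun h => ⟨auxL, ?_, auxR⟩⟩
    intro s hs
    rcases List.mem_append.1 hs with hs | hs
    · exact aux t s hs
    rcases List.mem_cons.1 hs with rfl | hs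
    · rintro _ ⟨⟩
      exact h
    · exact aux t' s hs
  | right q t =>
    refine ⟨fun h => h.2.2 q rfl, fun h => ⟨auxL, aux t, ?_⟩⟩
    rintro _ ⟨⟩
    exact h

theorem colStep_headless (t : List Γ) :
    M.cellChain.ColStep (t.map M.headless) none none (t.map M.headless) := by
  induction t with
  | nil => exact .nil _
  | cons x t ih => exact .cons (TrInner.idle x) ih

/-- The head enters at the left end of headless cells. -/
theorem Represents.exists_enterRight (p : Q) (t t' : List Γ) :
    ∃ (c : Crossing Q) (qs : List M.cellChain.C) (r : M.cellChain.R),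
      M.cellChain.ColStep (t'.map M.headless) (some (.inl p)) c qs ∧ M.TrRight none c r ∧
      M.Represents ⟨p, t ++ t', t.length + 1⟩ (none, t.map M.headless ++ qs, r) := by
  cases t' with
  | nil =>
    refine ⟨_, [], some p, .nil _, .enter p, ?_⟩
    simpa using Represents.right p t
  | cons x t' =>
    exact ⟨none, M.headed x p :: t'.map M.headless, none,
      .cons (TrInner.enterRight x p) (colStep_headless t'), .idle, .inner p t x t'⟩

/-- The head enters at the right end of headless cells. -/
theorem Represents.exists_enterLeft (p : Q) (t : List Γ) :
    ∃ (a : Crossing Q) (l : M.cellChain.L) (qs : List M.cellChain.C),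
      M.TrLeft none a l ∧ M.cellChain.ColStep (t.map M.headless) a (some (.inr p)) qs ∧
      ∀ t', M.Represents ⟨p, t ++ t', t.length⟩ (l, qs ++ t'.map M.headless, none) := by
  rcases t.eq_nil_or_concat with rfl | ⟨t, x, rfl⟩
  · exact ⟨_, some p, [], .enter p, .nil _, fun t' => .left p t'⟩
  · refine ⟨none, none, t.map M.headless ++ [M.headed x p], .idle, ?_, fun t' => ?_⟩
    · rw [List.concat_eq_append, List.map_append]
      exact (colStep_headless t).append (.cons (TrInner.enterLeft x p) (.nil _))
    · simpa using Represents.inner p t x t'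

theorem Represents.exists_step {c c' : Cfg Γ Q} {g : M.cellChain.Config} (h : M.Represents c g)
    (hc : M.step c = some c') : ∃ g', M.cellChain.Step g g' ∧ M.Represents c' g' := by
  cases h with
  | left q t =>
    obtain ⟨p, hp, rfl⟩ := Option.map_eq_some_iff.1 hc
    obtain ⟨c, qs, r, h, hr, h'⟩ := Represents.exists_enterRight (M := M) p [] t
    exact ⟨(none, qs, r), ⟨_, _, TrLeft.leave hp, h, hr⟩, h'⟩
  | inner q t x t' =>
    simp only [step, List.getElem?_append_right le_rfl, Nat.sub_self, List.getElem?_cons_zero,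
      Option.map_eq_some_iff, List.set_append_right _ _ le_rfl, List.set_cons_zero] at hc
    obtain ⟨⟨p, y, d⟩, hp, rfl⟩ := hc
    cases d with
    | left =>
      obtain ⟨a, l, qs, hl, h, h'⟩ := Represents.exists_enterLeft (M := M) p t
      exact ⟨(l, qs ++ (y :: t').map M.headless, none), ⟨a, none, hl,
        h.append (.cons (TrInner.leaveLeft hp) (colStep_headless t')), TrRight.idle⟩, h' _⟩
    | right =>
      -- The rewritten cell `y` joins the headless prefix that the head has passed.
      obtain ⟨c, qs, r, h, hr, h'⟩ := Represents.exists_enterRight (M := M) p (t ++ [y]) t'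
      refine ⟨(none, t.map M.headless ++ M.headless y :: qs, r), ⟨none, c, TrLeft.idle,
        (colStep_headless t).append (.cons (TrInner.leaveRight hp) h), hr⟩, ?_⟩
      simpa using h'
  | right q t =>
    simp only [step, List.getElem?_length, Option.map_eq_some_iff] at hc
    obtain ⟨p, hp, rfl⟩ := hc
    obtain ⟨a, l, qs, hl, h, h'⟩ := Represents.exists_enterLeft (M := M) p t
    refine ⟨(l, qs, none), ⟨a, _, hl, h, TrRight.leave hp⟩, ?_⟩
    simpa using h' []

/-- The cell with the head has no idle transition, so the chain is stuck when the machine is. With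
`exists_step` and determinism, this spares an analysis of arbitrary chain steps. -/
theorem Represents.isSome_step {c : Cfg Γ Q} {g g' : M.cellChain.Config} (h : M.Represents c g)
    (hg : M.cellChain.Step g g') : ∃ c', M.step c = some c' := by
  obtain ⟨a, b, hl, hs, hr⟩ := hg
  cases h with
  | left q t =>
    generalize g'.1 = l at hl
    cases hl with
    | leave h => exact ⟨_, congrArg (Option.map _) h⟩
  | inner q t x t' =>
    have key : ∃ p, M.onLetter q x = some p := by
      clear hl hr
      generalize g'.2.1 = qs at hs
      induction t generalizing a qs with
      | nil =>
        cases hs with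
        | cons h _ => cases h <;> exact ⟨_, by assumption⟩
      | cons y t ih =>
        cases hs with
        | cons _ hs => exact ih _ _ hs
    obtain ⟨p, hp⟩ := key
    simp only [step, List.getElem?_append_right le_rfl, Nat.sub_self, List.getElem?_cons_zero, hp,
      Option.map_some]
    exact ⟨_, rfl⟩
  | right q t =>
    generalize g'.2.2 = r at hr
    cases hr with
    | leave h =>
      simp only [step, List.getElem?_length, h, Option.map_some]
      exact ⟨_, rfl⟩

theorem Represents.accepting_iff {c : Cfg Γ Q} {g : M.cellChain.Config} (h : M.Represents c g) :
    M.cellChain.Accepting g ↔ ∃ c', StateTransition.Reaches M.step c c' ∧ c'.state ∈ M.accept := by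
  constructor
  · rintro ⟨g', hg, hf⟩
    induction hg using Relation.ReflTransGen.head_induction_on generalizing c with
    | refl => exact ⟨c, .refl, h.final_iff.1 hf⟩
    | head hs _ ih =>
      obtain ⟨c₁, hc₁⟩ := h.isSome_step hs
      obtain ⟨g₁, hg₁, h₁⟩ := h.exists_step hc₁
      obtain rfl := M.deterministic_cellChain.step_unique hs hg₁
      obtain ⟨c', hc', ha⟩ := ih h₁
      exact ⟨c', .head hc₁ hc', ha⟩
  · rintro ⟨c', hc, ha⟩
    induction hc using Relation.ReflTransGen.head_induction_on generalizing g with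
    | refl => exact ⟨g, .refl, h.final_iff.2 ha⟩
    | head hs _ ih =>
      obtain ⟨g₁, hg₁, h₁⟩ := h.exists_step hs
      exact CellChain.accepting_iff.2 (Or.inr ⟨g₁, hg₁, ih h₁⟩)

theorem language_eq_accepting (M : DetLBM A Γ Q) :
    M.language = {w | M.cellChain.Accepting
      (some M.start, w.map (fun a => M.headless (M.input a)), none)} := by
  ext w
  have h := Represents.left (M := M) M.start (w.map M.input)
  rw [List.map_map] at h
  exact h.accepting_iff.symm

end DetLBM

/-! ### From chains to machines: the sweeping simulation -/

/-- Some element with the property `P`, if there is one. -/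
noncomputable def Option.pick {α : Type} (P : α → Prop) : Option α :=
  open scoped Classical in if h : ∃ x, P x then some h.choose else none

theorem Option.pick_spec {α : Type} {P : α → Prop} {x : α} (h : Option.pick P = some x) : P x := by
  unfold Option.pick at h
  split_ifs at h with hP
  cases h
  exact hP.choose_spec

theorem Option.pick_eq_some {α : Type} {P : α → Prop} {x : α} (hx : P x)
    (h : ∀ y, P y → y = x) : Option.pick P = some x := by
  have hP : ∃ x, P x := ⟨x, hx⟩
  unfold Option.pick
  rw [dif_pos hP, h _ hP.choose_spec]

namespace CellChain

variable {Γ : Type} (X : CellChain Γ)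

/-- The control states of the sweeping machine: `Sum.inl (l, r, p, f)` in a sweep to the right,
where `p` is the last cell seen and `f` tells whether all cells seen are final, `Sum.inr (l, r, b)`
in a sweep to the left, where `b` is the letter exchanged at the current position, and `none` once
the input is accepted. The states of the end cells are `l` and `r`. -/
abbrev SweepState := Option ((X.L × X.R × (X.L ⊕ X.C) × Prop) ⊕ (X.L × X.R × Γ))

/-- The letter exchanged by two neighbours. -/
noncomputable def linkLetter (p : X.L ⊕ X.C) (s : X.C ⊕ X.R) : Option Γ :=
  Option.pick fun b => X.Emits p b ∧ X.Receives s b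

/-- The linearly bounded machine that simulates a chain. In a sweep to the right it checks whether
all cells are final and stores in each cell the letter exchanged with its left neighbour; in a sweep
to the left it updates the cells. -/
noncomputable def sweeper {A : Type*} (init : A ↪ X.C) (l : X.L) (r : X.R) :
    DetLBM A (X.C × Option Γ) X.SweepState where
  input := ⟨fun a => (init a, none), fun _ _ h => init.injective (congrArg Prod.fst h)⟩
  start := some (.inl (l, r, .inl l, l ∈ X.finL))
  accept := {none}
  onLeftEnd
    | some (.inl s) => some (some (.inl s))
    | some (.inr (l, r, b)) => (Option.pick (X.trL l b)).map fun l' =>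
        some (.inl (l', r, .inl l', l' ∈ X.finL))
    | none => none
  onRightEnd
    | some (.inl (l, r, p, f)) =>
        open scoped Classical in
        if f ∧ r ∈ X.finR then some none
        else (X.linkLetter p (.inr r)).bind fun b =>
          (Option.pick (X.trR r b)).map fun r' => some (.inr (l, r', b))
    | _ => none
  onLetter
    | some (.inl (l, r, p, f)), (q, _) =>
        some (some (.inl (l, r, .inr q, f ∧ q ∈ X.finC)), (q, X.linkLetter p (.inl q)), .right)
    | some (.inr (l, r, b)), (q, some a) => (Option.pick (X.trC q a b)).map fun q' =>
        (some (.inr (l, r, a)), (q', none), .left)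
    | _, _ => none

/-- The invariant of the sweeping machine started on the global state `g`. -/
def SweepInvariant (g : X.Config) : DetLBM.Cfg (X.C × Option Γ) X.SweepState → Prop
  | ⟨some (.inl (l, r, _, f)), t, h⟩ =>
      Relation.ReflTransGen X.Step g (l, t.map Prod.fst, r) ∧ h ≤ t.length + 1 ∧
        (f → l ∈ X.finL ∧ ∀ q ∈ (t.map Prod.fst).take (h - 1), q ∈ X.finC)
  | ⟨some (.inr (l, r, b)), t, h⟩ =>
      ∃ t₁ t₂ qs r₀ c, t = t₁ ++ t₂ ∧ t₁.length = h ∧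
        Relation.ReflTransGen X.Step g (l, t₁.map Prod.fst ++ qs, r₀) ∧
        X.ColStep qs b c (t₂.map Prod.fst) ∧ X.trR r₀ c r
  | ⟨none, _, _⟩ => X.Accepting g

variable {X} {A : Type*} {init : A ↪ X.C} {l₀ : X.L} {r₀ : X.R}

/-- Soundness needs no determinism: whatever letters were stored, the left sweep checks each
transition it uses and builds a `ColStep` from right to left, which the left end cell completes to a
global step. -/
theorem SweepInvariant.step {g : X.Config} {c c' : DetLBM.Cfg (X.C × Option Γ) X.SweepState}
    (hc : X.SweepInvariant g c) (h : (X.sweeper init l₀ r₀).step c = some c') :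
    X.SweepInvariant g c' := by
  obtain ⟨s, t, i⟩ := c
  rcases i with _ | i
  · obtain ⟨s', hs', rfl⟩ := Option.map_eq_some_iff.1 h
    rcases s with _ | ⟨l, r, p, f⟩ | ⟨l, r, b⟩
    · cases hs'
    · cases hs'
      -- By truncated subtraction the checked prefix is empty for head positions `0` and `1` alike.
      exact ⟨hc.1, by simp, hc.2.2⟩
    · obtain ⟨l', hl', rfl⟩ := Option.map_eq_some_iff.1 hs'
      obtain ⟨t₁, t₂, qs, r₁, c, rfl, ht, hg, hs, hr⟩ := hc
      obtain rfl := List.length_eq_zero_iff.1 ht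
      refine ⟨hg.tail ⟨b, c, Option.pick_spec hl', hs, hr⟩, by simp, fun h => ⟨h, ?_⟩⟩
      simp
  · simp only [DetLBM.step] at h
    cases hx : t[i]? with
    | none =>
      rw [hx] at h
      have hi := List.getElem?_eq_none_iff.1 hx
      obtain ⟨s', hs', rfl⟩ := Option.map_eq_some_iff.1 h
      rcases s with _ | ⟨l, r, p, f⟩ | ⟨l, r, b⟩
      · cases hs'
      · simp only [sweeper] at hs'
        obtain ⟨hg, hi', hf⟩ := hc
        split_ifs at hs' with hfr
        · cases hs'
          obtain ⟨hl, hq⟩ := hf hfr.1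
          rw [List.take_of_length_le (by simpa using hi)] at hq
          exact ⟨_, hg, hl, hq, hfr.2⟩
        · obtain ⟨b, -, hb⟩ := Option.bind_eq_some_iff.1 hs'
          obtain ⟨r', hr', rfl⟩ := Option.map_eq_some_iff.1 hb
          exact ⟨t, [], [], r, b, (List.append_nil t).symm, by omega, by simpa using hg, .nil b,
            Option.pick_spec hr'⟩
      · cases hs'
    | some x =>
      rw [hx] at h
      obtain ⟨hi, hxi⟩ := List.getElem?_eq_some_iff.1 hx
      obtain ⟨s', hs', rfl⟩ := Option.map_eq_some_iff.1 h
      rcases s with _ | ⟨l, r, p, f⟩ | ⟨l, r, b⟩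
      · cases hs'
      · cases hs'
        obtain ⟨hg, -, hf⟩ := hc
        have ht : (t.set i (x.1, X.linkLetter p (.inl x.1))).map Prod.fst = t.map Prod.fst := by
          rw [List.map_set, ← hxi]
          have := List.set_getElem_self (as := t.map Prod.fst) (i := i) (by simpa using hi)
          simpa using this
        refine ⟨by rwa [ht], by simpa using hi, fun h => ⟨(hf h.1).1, ?_⟩⟩
        intro q hq
        rw [ht, show i + 2 - 1 = i + 1 from rfl, List.take_add_one, List.mem_append] at hq
        rcases hq with hq | hq
        · exact (hf h.1).2 q hq
        · rw [List.getElem?_map, hx] at hq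
          obtain rfl : q = x.1 := by simpa using hq
          exact h.2
      · obtain ⟨x, _ | a⟩ := x
        · cases hs'
        obtain ⟨q', hq', rfl⟩ := Option.map_eq_some_iff.1 hs'
        obtain ⟨t₁, t₂, qs, r₁, c, rfl, ht, hg, hs, hr⟩ := hc
        -- The head is on the last cell not yet updated; it moves to the updated part, and its old
        -- state goes to the front of `qs`.
        rcases t₁.eq_nil_or_concat with rfl | ⟨t₁, y, rfl⟩
        · simp at ht
        obtain rfl : t₁.length = i := by simpa using ht
        obtain rfl : y = (x, some a) := by simpa using hx
        refine ⟨t₁, (q', none) :: t₂, x :: qs, r₁, c, by simp, rfl, by simpa using hg, ?_, hr⟩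
        exact .cons (Option.pick_spec hq') hs

theorem SweepInvariant.initial (w : List A) :
    X.SweepInvariant (l₀, w.map init, r₀) ((X.sweeper init l₀ r₀).initial w) := by
  refine ⟨?_, by simp, fun h => ⟨h, by simp⟩⟩
  have : ((w.map (X.sweeper init l₀ r₀).input).map Prod.fst) = w.map init := by
    rw [List.map_map]
    rfl
  exact this ▸ .refl

theorem accepting_of_mem_language_sweeper {w : List A}
    (h : w ∈ (X.sweeper init l₀ r₀).language) : X.Accepting (l₀, w.map init, r₀) := by
  obtain ⟨⟨s, t, i⟩, hc, rfl⟩ := h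
  have : ∀ c, StateTransition.Reaches (X.sweeper init l₀ r₀).step
      ((X.sweeper init l₀ r₀).initial w) c → X.SweepInvariant (l₀, w.map init, r₀) c := by
    intro c hc
    induction hc with
    | refl => exact .initial w
    | tail _ h ih => exact ih.step h
  exact this _ hc

theorem Deterministic.linkLetter_eq (hX : X.Deterministic) {p : X.L ⊕ X.C} {s : X.C ⊕ X.R} {b : Γ}
    (hp : X.Emits p b) (hs : X.Receives s b) : X.linkLetter p s = some b :=
  Option.pick_eq_some ⟨hp, hs⟩ fun _ h => hX.link _ _ _ _ h.1 h.2 hp hs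

theorem step_sweeper_go (l : X.L) (r : X.R) (p : X.L ⊕ X.C) (f : Prop)
    (t t' : List (X.C × Option Γ)) (x : X.C × Option Γ) :
    (X.sweeper init l₀ r₀).step ⟨some (.inl (l, r, p, f)), t ++ x :: t', t.length + 1⟩ =
      some ⟨some (.inl (l, r, .inr x.1, f ∧ x.1 ∈ X.finC)),
        (t ++ [(x.1, X.linkLetter p (.inl x.1))]) ++ t',
        (t ++ [(x.1, X.linkLetter p (.inl x.1))]).length + 1⟩ := by
  simp [DetLBM.step, sweeper]

/-- Induction on the cells `t'` still ahead covers the way out and the way back together.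
Determinism ensures that the stored letters are those of the given step, and `hf` excludes
acceptance at the right end. -/
theorem Deterministic.reaches_back (hX : X.Deterministic) {l : X.L} {r r' : X.R} {c : Γ}
    (hr : X.trR r c r') (t' : List (X.C × Option Γ)) {qs' : List X.C} {b : Γ}
    (hs : X.ColStep (t'.map Prod.fst) b c qs') (t : List (X.C × Option Γ)) (p : X.L ⊕ X.C)
    (f : Prop) (hp : X.Emits p b) (hf : ¬ (f ∧ (∀ q ∈ t'.map Prod.fst, q ∈ X.finC) ∧ r ∈ X.finR)) :
    StateTransition.Reaches (X.sweeper init l₀ r₀).step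
      ⟨some (.inl (l, r, p, f)), t ++ t', t.length + 1⟩
      ⟨some (.inr (l, r', b)), t ++ qs'.map fun q => (q, none), t.length⟩ := by
  induction t' generalizing qs' b t p f with
  | nil =>
    cases hs
    refine .single ?_
    have hr' : Option.pick (X.trR r c) = some r' :=
      Option.pick_eq_some hr fun _ h => hX.right _ _ _ _ h hr
    have hf' : ¬ (f ∧ r ∈ X.finR) := by simpa using hf
    simp [DetLBM.step, sweeper, hX.linkLetter_eq hp (s := .inr r) ⟨_, hr⟩, hr', hf']
  | cons x t' ih =>
    obtain ⟨q, a⟩ := x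
    cases hs with
    | @cons _ q' _ qs' _ b' _ hq hs =>
      refine .head (step_sweeper_go ..) ((ih hs _ (.inr q) _ ⟨_, _, hq⟩ ?_).trans (.single ?_))
      · simpa [and_assoc] using hf
      · have hq' : Option.pick (X.trC q b b') = some q' :=
          Option.pick_eq_some hq fun _ h => hX.inner _ _ _ _ _ h hq
        simp [DetLBM.step, sweeper, hX.linkLetter_eq hp (s := .inl q) ⟨_, _, hq⟩, hq']

theorem reaches_accept {l : X.L} {r : X.R} (t' t : List (X.C × Option Γ)) (p : X.L ⊕ X.C)
    (f : Prop) (hf : f ∧ (∀ q ∈ t'.map Prod.fst, q ∈ X.finC) ∧ r ∈ X.finR) :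
    ∃ c, StateTransition.Reaches (X.sweeper init l₀ r₀).step
      ⟨some (.inl (l, r, p, f)), t ++ t', t.length + 1⟩ c ∧ c.state = none := by
  induction t' generalizing t p f with
  | nil =>
    refine ⟨⟨none, t ++ [], t.length⟩, .single ?_, rfl⟩
    have hf' : f ∧ r ∈ X.finR := by simpa using hf
    simp [DetLBM.step, sweeper, hf']
  | cons x t' ih =>
    obtain ⟨c, hc, h⟩ := ih (t ++ [(x.1, X.linkLetter p (.inl x.1))]) (.inr x.1)
      (f ∧ x.1 ∈ X.finC) (by simpa [and_assoc] using hf)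
    exact ⟨c, .head (step_sweeper_go ..) hc, h⟩

theorem Deterministic.mem_language_sweeper (hX : X.Deterministic) {w : List A}
    (h : X.Accepting (l₀, w.map init, r₀)) : w ∈ (X.sweeper init l₀ r₀).language := by
  obtain ⟨g', hg, hfin⟩ := h
  have key : ∀ g, Relation.ReflTransGen X.Step g g' → ∀ t : List (X.C × Option Γ),
      t.map Prod.fst = g.2.1 → ∃ c, StateTransition.Reaches (X.sweeper init l₀ r₀).step
        ⟨some (.inl (g.1, g.2.2, .inl g.1, g.1 ∈ X.finL)), t, 1⟩ c ∧ c.state = none := by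
    intro g hg
    induction hg using Relation.ReflTransGen.head_induction_on with
    | refl =>
      intro t ht
      exact reaches_accept t [] _ _ (ht ▸ hfin)
    | @head g g₁ h₁ _ ih =>
      intro t ht
      -- The machine stops at the first final state, possibly before `g'`. Otherwise one round trip
      -- leads from `g` to `g₁`, whatever letters `t` stores.
      by_cases hf : X.Final g
      · exact reaches_accept t [] _ _ (ht ▸ hf)
      obtain ⟨a, c, hl, hs, hr⟩ := h₁
      have hback := hX.reaches_back (init := init) (l₀ := l₀) (r₀ := r₀) (l := g.1) hr t (ht ▸ hs) []
        (.inl g.1) (g.1 ∈ X.finL) ⟨_, hl⟩ (ht ▸ hf)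
      obtain ⟨c, hc, h⟩ := ih (g₁.2.1.map fun q => (q, none)) (by simp [Function.comp_def])
      refine ⟨c, hback.trans (.head ?_ hc), h⟩
      have hl' : Option.pick (X.trL g.1 a) = some g₁.1 :=
        Option.pick_eq_some hl fun _ h => hX.left _ _ _ _ h hl
      simp [DetLBM.step, sweeper, hl']
  obtain ⟨c, hc, h⟩ := key _ hg (w.map (X.sweeper init l₀ r₀).input) (by
    rw [List.map_map]
    rfl)
  -- The extra step takes the head off the left endmarker.
  exact ⟨c, .head rfl hc, h⟩

/-- A language accepted by deterministic chains is deterministic context-sensitive. -/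
theorem Deterministic.isDetContextSensitive [Finite Γ] [Finite X.L] [Finite X.C] [Finite X.R]
    (hX : X.Deterministic) (init : A ↪ X.C) (l : X.L) (r : X.R) :
    Language.IsDetContextSensitive {w : List A | X.Accepting (l, w.map init, r)} := by
  refine ⟨X.C × Option Γ, X.SweepState, inferInstance, inferInstance, X.sweeper init l r, ?_⟩
  ext w
  exact ⟨accepting_of_mem_language_sweeper, hX.mem_language_sweeper⟩

end CellChain

theorem mainTheorem5 {A : Type*} [Finite A] (L : Language A) (hL : [] ∉ L) :
    L.IsDetContextSensitive ↔
      ∃ (Γ : Type) (_ : Finite Γ) (G : SyncRationalGraph A Γ) (I F : Language Γ)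
        (hI : I.IsRegular) (hF : F.IsRegular),
        L = G.pathLanguage I F ∧ G.IsGloballyDeterministic I F hI hF := by
  constructor
  · rintro ⟨Γ, Q, _, _, M, rfl⟩
    have : Finite M.cellChain.L := inferInstanceAs (Finite (Option Q))
    have : Finite M.cellChain.C := inferInstanceAs (Finite (Γ × Option Q))
    have : Finite M.cellChain.R := inferInstanceAs (Finite (Option Q))
    rw [M.language_eq_accepting]
    exact ⟨_, inferInstance, M.deterministic_cellChain.exists_graph _ _ _⟩
  · rintro ⟨Γ, _, G, I, F, hI, hF, rfl, h⟩
    obtain ⟨X, hX, _, _, _, init, l, r, e⟩ := h.exists_cellChain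
    rw [e]
    exact hX.isDetContextSensitive init l r
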